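/- Let $P$ be a real $n\times n$ matrix, not necessarily symmetric (such as an approximate spectral projector of a non-symmetric matrix), with $\operatorname{tr}(P)>0$. Let $\varepsilon>0$ and $0<\delta<1$, and let $M$ be a positive integer with $$M\;\ge\;\frac{8\,\varepsilon^{-2}\bigl(\|P\|_F^2+2\,\|P\|\,\varepsilon\,\operatorname{tr}(P)\bigr)\ln(2/\delta)}{\operatorname{tr}(P)^2},$$ where $\|P\|_F$ is the Frobenius norm and $\|P\|$ the spectral norm (the operator norm induced by the Euclidean norm) of $P$. Let $z_1,\dots,z_M$ be random vectors in $\mathbb{R}^n$ whose $Mn$ components $z_{ij}$ are independent Rademacher random variables, $\Pr(z_{ij}=1)=\Pr(z_{ij}=-1)=\tfrac12$, and let $$H_M=\frac1M\sum_{i=1}^M z_i^TPz_i .$$ Then $$\Pr\bigl(|H_M-\operatorname{tr}(P)|\ge\varepsilon\,\operatorname{tr}(P)\bigr)\le\delta .$$ -/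

import Mathlib

open MeasureTheory ProbabilityTheory

noncomputable section

/-- The spectral norm of a real square matrix: the operator norm induced by the Euclidean norm. -/
def spectralNorm₂ {n : ℕ} (P : Matrix (Fin n) (Fin n) ℝ) : ℝ :=
  ‖Matrix.toEuclideanCLM (n := Fin n) (𝕜 := ℝ) P‖

/-- The Frobenius norm of a real square matrix. -/
def frobeniusNorm {n : ℕ} (P : Matrix (Fin n) (Fin n) ℝ) : ℝ :=
  Real.sqrt (∑ i, ∑ j, P i j ^ 2)

/-- A Rademacher random variable takes each of the values `1` and `-1` with probability `1/2`. -/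
structure IsRademacher {Ω : Type*} [MeasurableSpace Ω] (X : Ω → ℝ) (μ : Measure Ω) : Prop where
  measurable : Measurable X
  prob_one : μ {ω | X ω = 1} = 1 / 2
  prob_neg_one : μ {ω | X ω = -1} = 1 / 2

/-- The Hutchinson trace estimator `(1 / M) * ∑ i, zᵢᵀ P zᵢ` with sample vectors `z₁, …, z_M`;
`z i j` is the `j`-th component of the `i`-th random vector. -/
def hutchinson {Ω : Type*} {n M : ℕ} (P : Matrix (Fin n) (Fin n) ℝ)
    (z : Fin M → Fin n → Ω → ℝ) (ω : Ω) : ℝ :=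
  (1 / (M : ℝ)) * ∑ i, (fun j => z i j ω) ⬝ᵥ (P.mulVec fun j => z i j ω)

end

/-!
Since `z i j ^ 2 = 1`, the diagonal of `P` contributes exactly `P.trace` to each `zᵢᵀ P zᵢ`, so
`M (H_M - tr P)` is a Rademacher chaos `∑ zᵢᵀ A zᵢ`, where `A` is the symmetric part of `P` with
its diagonal removed (`symOffDiag`, `ae_sum_symOffDiag_eq`). This matrix satisfies
`‖A‖_F ≤ ‖P‖_F` and `|xᵀ A x| ≤ 2 ‖P‖ |x|²`.

The exponential moments of such a chaos are dominated by those of the Gaussian chaos with the same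
matrix: `E exp (zᵀ A z / 2) ≤ det (1 - A) ^ (-1/2)`. No Gaussian variable is needed for this. With
`C = 1 - A`, averaging over the sign of one coordinate and using `cosh b ≤ exp (b² / 2)` replaces
the form of `C` by that of its Schur complement, at the price of the pivot's inverse square root;
positive definiteness and the condition that the diagonal be at most one are inherited, and the
pivots multiply up to `det C` (`lintegral_exp_le_one_div_sqrt_det`). As `A` has trace zero, an
eigenvalue expansion bounds the determinant by `exp (‖A‖_F² / (2 (1 - r)))` whenever the form of
`A` is at most `r < 1` in absolute value (`one_div_sqrt_det_one_sub_le`).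

The `M` samples together form a single Rademacher vector and the chaos has a block diagonal matrix,
so Markov's inequality for the exponential with Bernstein's choice of parameter gives
`exp (-M t² / (8 ‖P‖_F² + 16 ‖P‖ t))` for each tail (`measure_le_sum_chaos_le`). With
`t = ε tr P` this is at most `δ / 2` under the assumption on `M`.
-/

open Matrix

/-! ### The Rademacher law -/

/-- The Rademacher law on `ℝ`, giving mass `1/2` to each of `1` and `-1`. -/
noncomputable def rademacherLaw : Measure ℝ :=
  (1 / 2 : ENNReal) • Measure.dirac 1 + (1 / 2 : ENNReal) • Measure.dirac (-1)

instance isProbabilityMeasure_rademacherLaw : IsProbabilityMeasure rademacherLaw :=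
  ⟨by simp [rademacherLaw, ENNReal.inv_two_add_inv_two]⟩

theorem lintegral_rademacherLaw (f : ℝ → ENNReal) :
    ∫⁻ s, f s ∂rademacherLaw = 1 / 2 * f 1 + 1 / 2 * f (-1) := by
  simp [rademacherLaw]

theorem IsRademacher.map_eq {Ω : Type*} [MeasurableSpace Ω] {μ : Measure Ω}
    [IsProbabilityMeasure μ] {X : Ω → ℝ} (hX : IsRademacher X μ) :
    μ.map X = rademacherLaw := by
  have : IsProbabilityMeasure (μ.map X) :=
    Measure.isProbabilityMeasure_map hX.measurable.aemeasurable
  refine (Measure.eq_of_le_of_isProbabilityMeasure (Measure.le_iff.2 fun s hs => ?_)).symm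
  rw [Measure.map_apply hX.measurable hs]
  have hdisj : Disjoint {ω | X ω = 1} {ω | X ω = -1} := by
    rw [Set.disjoint_left]
    intro ω h1 h2
    simp only [Set.mem_ofPred_eq] at h1 h2
    linarith
  have hm : MeasurableSet {ω | X ω = -1} := hX.measurable (measurableSet_singleton (-1))
  have hsum : μ ({ω | X ω = 1} ∪ {ω | X ω = -1}) = 1 / 2 + 1 / 2 := by
    rw [measure_union hdisj hm, hX.prob_one, hX.prob_neg_one]
  by_cases h1 : (1 : ℝ) ∈ s <;> by_cases h2 : (-1 : ℝ) ∈ s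
  · simp only [rademacherLaw, Measure.add_apply, Measure.smul_apply, Measure.dirac_apply' _ hs,
      Set.indicator_of_mem h1, Set.indicator_of_mem h2, Pi.one_apply, smul_eq_mul, mul_one]
    rw [← hsum]
    refine measure_mono ?_
    rintro ω (h | h) <;> simp only [Set.mem_ofPred_eq] at h <;> simp [h, h1, h2]
  · simp only [rademacherLaw, Measure.add_apply, Measure.smul_apply, Measure.dirac_apply' _ hs,
      Set.indicator_of_mem h1, Set.indicator_of_notMem h2, Pi.one_apply, smul_eq_mul, mul_one,
      mul_zero, add_zero]
    rw [← hX.prob_one]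
    refine measure_mono fun ω h => ?_
    simp only [Set.mem_ofPred_eq] at h
    simp [h, h1]
  · simp only [rademacherLaw, Measure.add_apply, Measure.smul_apply, Measure.dirac_apply' _ hs,
      Set.indicator_of_notMem h1, Set.indicator_of_mem h2, Pi.one_apply, smul_eq_mul, mul_one,
      mul_zero, zero_add]
    rw [← hX.prob_neg_one]
    refine measure_mono fun ω h => ?_
    simp only [Set.mem_ofPred_eq] at h
    simp [h, h2]
  · simp [rademacherLaw, Measure.dirac_apply' _ hs, h1, h2]

theorem IsRademacher.ae_sq_eq_one {Ω : Type*} [MeasurableSpace Ω] {μ : Measure Ω}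
    [IsProbabilityMeasure μ] {X : Ω → ℝ} (hX : IsRademacher X μ) :
    ∀ᵐ ω ∂μ, X ω ^ 2 = 1 := by
  have h : ∀ᵐ x ∂(μ.map X), x ^ 2 = 1 := by
    rw [hX.map_eq, rademacherLaw, ae_add_measure_iff]
    constructor <;> refine Measure.ae_smul_measure ?_ _ <;> simp [ae_dirac_eq]
  exact ae_of_ae_map hX.measurable.aemeasurable h

/-! ### Quadratic forms and Schur complements -/

theorem dotProduct_mulVec_cons {k : ℕ} {C : Matrix (Fin (k + 1)) (Fin (k + 1)) ℝ}
    (hC : C.IsHermitian) (s : ℝ) (y : Fin k → ℝ) :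
    (Fin.cons s y : Fin (k + 1) → ℝ) ⬝ᵥ C *ᵥ (Fin.cons s y : Fin (k + 1) → ℝ) =
      C 0 0 * s ^ 2 + 2 * s * ∑ i, C 0 i.succ * y i + ∑ i, ∑ j, y i * C i.succ j.succ * y j := by
  have hs : ∀ i : Fin k, C i.succ 0 = C 0 i.succ := fun i => by simpa using hC.apply 0 i.succ
  simp only [dotProduct, mulVec, Fin.sum_univ_succ, Fin.cons_zero, Fin.cons_succ, hs, mul_add,
    Finset.sum_add_distrib, Finset.mul_sum]
  have h1 : ∀ i : Fin k, y i * (C 0 i.succ * s) = s * (C 0 i.succ * y i) := fun i => by ring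
  have h2 : ∀ i : Fin k, 2 * s * (C 0 i.succ * y i) = 2 * (s * (C 0 i.succ * y i)) :=
    fun i => by ring
  simp only [h1, h2, ← Finset.mul_sum, mul_assoc]
  ring

/-- The Schur complement of the top left entry of a symmetric matrix; only the first row of `C` is
read, the first column being its mirror image. -/
noncomputable def schurCorner {k : ℕ} (C : Matrix (Fin (k + 1)) (Fin (k + 1)) ℝ) :
    Matrix (Fin k) (Fin k) ℝ :=
  Matrix.of fun i j => C i.succ j.succ - C 0 i.succ * C 0 j.succ / C 0 0

theorem dotProduct_mulVec_schurCorner {k : ℕ} (C : Matrix (Fin (k + 1)) (Fin (k + 1)) ℝ)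
    (y : Fin k → ℝ) :
    y ⬝ᵥ schurCorner C *ᵥ y =
      ∑ i, ∑ j, y i * C i.succ j.succ * y j - (∑ i, C 0 i.succ * y i) ^ 2 / C 0 0 := by
  have : (∑ i, C 0 i.succ * y i) ^ 2 / C 0 0 =
      ∑ i, ∑ j, y i * (C 0 i.succ * C 0 j.succ / C 0 0) * y j := by
    rw [sq, Finset.sum_mul_sum, Finset.sum_div]
    refine Finset.sum_congr rfl fun i _ => ?_
    rw [Finset.sum_div]
    exact Finset.sum_congr rfl fun j _ => by ring
  rw [this]
  simp only [dotProduct, mulVec, schurCorner, of_apply, Finset.mul_sum, ← Finset.sum_sub_distrib]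
  exact Finset.sum_congr rfl fun i _ => Finset.sum_congr rfl fun j _ => by ring

theorem posDef_schurCorner {k : ℕ} {C : Matrix (Fin (k + 1)) (Fin (k + 1)) ℝ} (hC : C.PosDef) :
    (schurCorner C).PosDef := by
  have h0 : 0 < C 0 0 := hC.diag_pos
  refine PosDef.of_dotProduct_mulVec_pos ?_ fun y hy => ?_
  · ext i j
    have := hC.1.apply i.succ j.succ
    simp only [star_trivial] at this
    simp [schurCorner, this, mul_comm]
  · -- The form of the complement is the form of `C` minimized over the first coordinate.
    set b := ∑ i, C 0 i.succ * y i with hb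
    have hne : (Fin.cons (-b / C 0 0) y : Fin (k + 1) → ℝ) ≠ 0 := by
      intro h
      apply hy
      ext i
      simpa using congrFun h i.succ
    have := hC.dotProduct_mulVec_pos hne
    rw [star_trivial, dotProduct_mulVec_cons hC.1, ← hb] at this
    rw [star_trivial, dotProduct_mulVec_schurCorner, ← hb]
    convert this using 1
    field_simp
    ring

theorem det_eq_mul_det_schurCorner {k : ℕ} {C : Matrix (Fin (k + 1)) (Fin (k + 1)) ℝ}
    (hC : C.PosDef) : C.det = C 0 0 * (schurCorner C).det := by
  have h0 : C 0 0 ≠ 0 := hC.diag_pos.ne'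
  have hs : ∀ i : Fin k, C i.succ 0 = C 0 i.succ := fun i => by simpa using hC.1.apply 0 i.succ
  -- Gaussian elimination of the first column.
  let c : Fin (k + 1) → ℝ := Fin.cons 0 fun i => C 0 i.succ / C 0 0
  let B : Matrix (Fin (k + 1)) (Fin (k + 1)) ℝ := Matrix.of fun i j => C i j - c i * C 0 j
  have hB0 : ∀ j, B 0 j = C 0 j := fun j => by simp [B, c]
  have hdet : C.det = B.det :=
    det_eq_of_forall_row_eq_smul_add_const c 0 (by simp [c]) fun i j => by
      rw [hB0]; simp [B]
  have hcol : ∀ i : Fin k, B i.succ 0 = 0 := fun i => by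
    simp only [B, c, of_apply, Fin.cons_succ, hs]
    field_simp
    ring
  rw [hdet, det_succ_column_zero, Fin.sum_univ_succ]
  simp only [hcol, hB0, Fin.val_zero, pow_zero, one_mul, mul_zero, zero_mul, Finset.sum_const_zero,
    add_zero]
  congr 2
  ext i j
  simp only [submatrix_apply, B, c, of_apply, Fin.cons_succ, schurCorner, Fin.succAbove_zero]
  ring

/-! ### Exponential moments of a Rademacher chaos -/

theorem exp_half_le_one_div_sqrt {c : ℝ} (hc : 0 < c) :
    Real.exp ((1 - c) / 2) ≤ 1 / Real.sqrt c := by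
  rw [le_div_iff₀ (Real.sqrt_pos.2 hc)]
  have h : Real.sqrt c ≤ Real.exp ((c - 1) / 2) := by
    rw [Real.sqrt_le_left (Real.exp_pos _).le, ← Real.exp_nat_mul]
    have := Real.add_one_le_exp (c - 1)
    ring_nf at this ⊢
    linarith
  calc _ ≤ Real.exp ((1 - c) / 2) * Real.exp ((c - 1) / 2) := by gcongr
    _ = 1 := by rw [← Real.exp_add]; ring_nf; exact Real.exp_zero

/-- Averaging over the sign of one coordinate replaces the form of `C` by its Schur complement. -/
theorem average_exp_le_schurCorner {k : ℕ} {C : Matrix (Fin (k + 1)) (Fin (k + 1)) ℝ}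
    (hC : C.PosDef) (hd : C 0 0 ≤ 1) (y : Fin k → ℝ) :
    1 / 2 * Real.exp (((Fin.cons 1 y : Fin (k + 1) → ℝ) ⬝ᵥ (Fin.cons 1 y : Fin (k + 1) → ℝ) -
        (Fin.cons 1 y : Fin (k + 1) → ℝ) ⬝ᵥ C *ᵥ (Fin.cons 1 y : Fin (k + 1) → ℝ)) / 2) +
      1 / 2 * Real.exp (((Fin.cons (-1) y : Fin (k + 1) → ℝ) ⬝ᵥ
        (Fin.cons (-1) y : Fin (k + 1) → ℝ) -
        (Fin.cons (-1) y : Fin (k + 1) → ℝ) ⬝ᵥ C *ᵥ (Fin.cons (-1) y : Fin (k + 1) → ℝ)) / 2) ≤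
      1 / Real.sqrt (C 0 0) * Real.exp ((y ⬝ᵥ y - y ⬝ᵥ schurCorner C *ᵥ y) / 2) := by
  have h0 : 0 < C 0 0 := hC.diag_pos
  have hcons : ∀ s : ℝ, (Fin.cons s y : Fin (k + 1) → ℝ) ⬝ᵥ (Fin.cons s y : Fin (k + 1) → ℝ) =
      s ^ 2 + y ⬝ᵥ y := fun s => by simp [dotProduct, Fin.sum_univ_succ, sq]
  rw [dotProduct_mulVec_cons hC.1, dotProduct_mulVec_cons hC.1, dotProduct_mulVec_schurCorner,
    hcons, hcons]
  set b := ∑ i, C 0 i.succ * y i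
  set q := ∑ i, ∑ j, y i * C i.succ j.succ * y j
  have e1 : Real.exp ((1 ^ 2 + y ⬝ᵥ y - (C 0 0 * 1 ^ 2 + 2 * 1 * b + q)) / 2) =
      Real.exp ((1 - C 0 0) / 2) * Real.exp ((y ⬝ᵥ y - q) / 2) * Real.exp (-b) := by
    rw [← Real.exp_add, ← Real.exp_add]; ring_nf
  have e2 : Real.exp (((-1) ^ 2 + y ⬝ᵥ y - (C 0 0 * (-1) ^ 2 + 2 * (-1) * b + q)) / 2) =
      Real.exp ((1 - C 0 0) / 2) * Real.exp ((y ⬝ᵥ y - q) / 2) * Real.exp b := by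
    rw [← Real.exp_add, ← Real.exp_add]; ring_nf
  have e3 : Real.exp ((y ⬝ᵥ y - (q - b ^ 2 / C 0 0)) / 2) =
      Real.exp ((y ⬝ᵥ y - q) / 2) * Real.exp (b ^ 2 / C 0 0 / 2) := by
    rw [← Real.exp_add]; ring_nf
  have hcosh : 1 / 2 * Real.exp (-b) + 1 / 2 * Real.exp b ≤ Real.exp (b ^ 2 / C 0 0 / 2) := by
    have hb : b ^ 2 ≤ b ^ 2 / C 0 0 := le_div_self (sq_nonneg b) h0 hd
    calc _ = Real.cosh b := by rw [Real.cosh_eq]; ring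
      _ ≤ Real.exp (b ^ 2 / 2) := Real.cosh_le_exp_half_sq b
      _ ≤ _ := by gcongr
  rw [e1, e2, e3]
  calc _ = Real.exp ((1 - C 0 0) / 2) * (Real.exp ((y ⬝ᵥ y - q) / 2) *
        (1 / 2 * Real.exp (-b) + 1 / 2 * Real.exp b)) := by ring
    _ ≤ _ := by
      gcongr
      exact exp_half_le_one_div_sqrt h0

/-- A Rademacher vector satisfies the Gaussian determinant bound when `C` has diagonal at most
one. The diagonal condition survives passing to a Schur complement, so the coordinates can be
averaged out one at a time. -/
theorem lintegral_exp_le_one_div_sqrt_det {k : ℕ} {C : Matrix (Fin k) (Fin k) ℝ}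
    (hC : C.PosDef) (hd : ∀ i, C i i ≤ 1) :
    ∫⁻ x : Fin k → ℝ, ENNReal.ofReal (Real.exp ((x ⬝ᵥ x - x ⬝ᵥ C *ᵥ x) / 2))
        ∂(Measure.pi fun _ => rademacherLaw) ≤
      ENNReal.ofReal (1 / Real.sqrt C.det) := by
  induction k with
  | zero => simp
  | succ k ih =>
    have h0 : 0 < C 0 0 := hC.diag_pos
    have hd' : ∀ i, schurCorner C i i ≤ 1 := fun i => by
      have : 0 ≤ C 0 i.succ * C 0 i.succ / C 0 0 :=
        div_nonneg (mul_self_nonneg _) h0.le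
      have := hd i.succ
      simp only [schurCorner, of_apply]
      linarith
    have hmeas : Measurable fun x : Fin (k + 1) → ℝ =>
        ENNReal.ofReal (Real.exp ((x ⬝ᵥ x - x ⬝ᵥ C *ᵥ x) / 2)) := by
      simp only [dotProduct, mulVec]
      fun_prop
    have hmp := (measurePreserving_piFinSuccAbove
      (fun _ : Fin (k + 1) => rademacherLaw) 0).symm
    have hcons : ∀ (s : ℝ) (y : Fin k → ℝ),
        (MeasurableEquiv.piFinSuccAbove (fun _ => ℝ) 0).symm (s, y) =
          (Fin.cons s y : Fin (k + 1) → ℝ) := fun s y => by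
      simp [MeasurableEquiv.piFinSuccAbove_symm_apply, Fin.insertNthEquiv]
    have hmeas' := (hmeas.comp hmp.measurable).aemeasurable
      (μ := rademacherLaw.prod (Measure.pi fun _ : Fin k => rademacherLaw))
    simp only [Function.comp_def] at hmeas'
    rw [← hmp.lintegral_comp hmeas, lintegral_prod_symm _ hmeas']
    simp only [lintegral_rademacherLaw, hcons]
    calc _ ≤ ∫⁻ y : Fin k → ℝ, ENNReal.ofReal (1 / Real.sqrt (C 0 0)) *
          ENNReal.ofReal (Real.exp ((y ⬝ᵥ y - y ⬝ᵥ schurCorner C *ᵥ y) / 2))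
            ∂(Measure.pi fun _ => rademacherLaw) := by
          refine lintegral_mono fun y => ?_
          rw [← ENNReal.ofReal_mul (by positivity)]
          refine le_trans (le_of_eq ?_)
            (ENNReal.ofReal_le_ofReal (average_exp_le_schurCorner hC (hd 0) y))
          have h2 : (1 / 2 : ENNReal) = ENNReal.ofReal (1 / 2) := by
            rw [ENNReal.ofReal_div_of_pos two_pos]; simp
          rw [ENNReal.ofReal_add (by positivity) (by positivity),
            ENNReal.ofReal_mul (by norm_num), ENNReal.ofReal_mul (by norm_num), h2]
      _ ≤ ENNReal.ofReal (1 / Real.sqrt (C 0 0)) *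
          ENNReal.ofReal (1 / Real.sqrt (schurCorner C).det) := by
          rw [lintegral_const_mul' _ _ ENNReal.ofReal_ne_top]
          gcongr
          exact ih (posDef_schurCorner hC) hd'
      _ = _ := by
          rw [← ENNReal.ofReal_mul (by positivity), det_eq_mul_det_schurCorner hC,
            Real.sqrt_mul h0.le, div_mul_div_comm, one_mul]

/-- With eigenvalues `aᵢ` of `A`, this is `-log (1 - aᵢ) ≤ aᵢ / (1 - aᵢ) ≤ aᵢ + aᵢ² / (1 - r)`
summed over `i`, the linear terms adding up to the trace. -/
theorem one_div_sqrt_det_one_sub_le {ι : Type*} [Fintype ι] [DecidableEq ι] {A : Matrix ι ι ℝ}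
    (hA : A.IsHermitian) (htr : A.trace = 0) {r : ℝ} (hr1 : r < 1)
    (hr : ∀ x : ι → ℝ, |x ⬝ᵥ A *ᵥ x| ≤ r * (x ⬝ᵥ x)) :
    1 / Real.sqrt (1 - A).det ≤ Real.exp ((∑ i, ∑ j, A i j ^ 2) / (2 * (1 - r))) := by
  set a := hA.eigenvalues with ha
  set U := hA.eigenvectorUnitary
  have hspec : A = (U : Matrix ι ι ℝ) * diagonal a * star (U : Matrix ι ι ℝ) := by
    simpa using hA.spectral_theorem
  have hUU : star (U : Matrix ι ι ℝ) * (U : Matrix ι ι ℝ) = 1 := Unitary.coe_star_mul_self U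
  have hUU' : (U : Matrix ι ι ℝ) * star (U : Matrix ι ι ℝ) = 1 := Unitary.coe_mul_star_self U
  have hsum : ∑ i, a i = 0 := by
    have := hA.trace_eq_sum_eigenvalues
    rw [htr] at this
    simpa using this.symm
  have hsq : ∑ i, ∑ j, A i j ^ 2 = ∑ i, a i ^ 2 := by
    calc ∑ i, ∑ j, A i j ^ 2 = (A * A).trace := by
          simp only [trace, diag, mul_apply]
          refine Finset.sum_congr rfl fun i _ => Finset.sum_congr rfl fun j _ => ?_
          have : A j i = A i j := by simpa using hA.apply i j
          rw [this, sq]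
      _ = (diagonal a * diagonal a).trace := by
          have : A * A = (U : Matrix ι ι ℝ) * (diagonal a * diagonal a) *
              star (U : Matrix ι ι ℝ) := by
            calc A * A = (U : Matrix ι ι ℝ) * diagonal a *
                  (star (U : Matrix ι ι ℝ) * (U : Matrix ι ι ℝ)) * diagonal a *
                  star (U : Matrix ι ι ℝ) := by
                  conv_lhs => rw [hspec]
                  simp only [mul_assoc]
              _ = _ := by rw [hUU]; simp only [mul_assoc, mul_one]
          rw [this, trace_mul_comm, ← mul_assoc, hUU, one_mul]
      _ = _ := by simp [diagonal_mul_diagonal, trace_diagonal, sq]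
  have hdet : (1 - A).det = ∏ i, (1 - a i) := by
    have : 1 - A = (U : Matrix ι ι ℝ) * diagonal (fun i => 1 - a i) *
        star (U : Matrix ι ι ℝ) := by
      have hd : diagonal (fun i => 1 - a i) = 1 - diagonal a := by
        rw [← diagonal_one, diagonal_sub]
      rw [hd, mul_sub, sub_mul, ← hspec, mul_one, hUU']
    rw [this, det_mul_comm, ← mul_assoc, hUU, one_mul, det_diagonal]
  have habs : ∀ i, |a i| ≤ r := fun i => by
    have h := hr (hA.eigenvectorBasis i)
    have h1 : (hA.eigenvectorBasis i : ι → ℝ) ⬝ᵥ (hA.eigenvectorBasis i : ι → ℝ) = 1 := by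
      have := EuclideanSpace.inner_eq_star_dotProduct (hA.eigenvectorBasis i)
        (hA.eigenvectorBasis i)
      rw [real_inner_self_eq_norm_sq, hA.eigenvectorBasis.orthonormal.1 i] at this
      simpa using this.symm
    have h2 := hA.eigenvalues_eq i
    rw [star_trivial, RCLike.re_to_real] at h2
    rw [h1, ← h2, mul_one] at h
    exact h
  have hpos : ∀ i, 0 < 1 - a i := fun i => by linarith [le_abs_self (a i), habs i]
  have hterm : ∀ i, -(a i + a i ^ 2 / (1 - r)) ≤ Real.log (1 - a i) := fun i => by
    have h1 := Real.one_sub_inv_le_log_of_pos (hpos i)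
    have h2 : 1 - (1 - a i)⁻¹ = -(a i + a i ^ 2 / (1 - a i)) := by
      have := (hpos i).ne'
      field_simp
      ring
    have h3 : a i ^ 2 / (1 - a i) ≤ a i ^ 2 / (1 - r) := by
      have : 0 < 1 - r := by linarith
      gcongr
      linarith [le_abs_self (a i), habs i]
    linarith
  have hdpos : 0 < (1 - A).det := hdet ▸ Finset.prod_pos fun i _ => hpos i
  rw [← Real.exp_log (Real.sqrt_pos.2 hdpos), one_div, ← Real.exp_neg, Real.exp_le_exp,
    Real.log_sqrt hdpos.le, hdet, Real.log_prod fun i _ => (hpos i).ne', hsq]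
  have := Finset.sum_le_sum fun i (_ : i ∈ Finset.univ) => hterm i
  rw [Finset.sum_neg_distrib, Finset.sum_add_distrib, hsum, ← Finset.sum_div] at this
  have h3 : (∑ i, a i ^ 2) / (2 * (1 - r)) = (∑ i, a i ^ 2) / (1 - r) / 2 := by
    rw [mul_comm, div_div]
  rw [h3]
  linarith

theorem lintegral_exp_chaos_le {ι : Type*} [Fintype ι] [DecidableEq ι] {A : Matrix ι ι ℝ}
    (hA : A.IsHermitian) (hdiag : ∀ i, A i i = 0) {r : ℝ} (hr1 : r < 1)
    (hr : ∀ x : ι → ℝ, |x ⬝ᵥ A *ᵥ x| ≤ r * (x ⬝ᵥ x))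
    {Ω : Type*} [MeasurableSpace Ω] {μ : Measure Ω} [IsProbabilityMeasure μ]
    {z : ι → Ω → ℝ} (hz : ∀ i, IsRademacher (z i) μ) (hindep : iIndepFun z μ) :
    ∫⁻ ω, ENNReal.ofReal (Real.exp (((fun i => z i ω) ⬝ᵥ A *ᵥ (fun i => z i ω)) / 2)) ∂μ ≤
      ENNReal.ofReal (Real.exp ((∑ i, ∑ j, A i j ^ 2) / (2 * (1 - r)))) := by
  let e := (Fintype.equivFin ι).symm
  have hC : (1 - A).PosDef := by
    refine PosDef.of_dotProduct_mulVec_pos (isHermitian_one.sub hA) fun x hx => ?_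
    have hxx : 0 < x ⬝ᵥ x := by
      have := dotProduct_star_self_pos_iff (v := x)
      rw [star_trivial] at this
      exact this.2 hx
    have h := (abs_le.1 (hr x)).2
    rw [star_trivial, sub_mulVec, one_mulVec, dotProduct_sub]
    nlinarith
  have hC' : ((1 - A).submatrix e e).PosDef := hC.submatrix e.injective
  have hbound := lintegral_exp_le_one_div_sqrt_det hC' (fun i => by simp [hdiag])
  rw [det_submatrix_equiv_self] at hbound
  have hlaw : μ.map (fun ω i => z (e i) ω) = Measure.pi fun _ => rademacherLaw := by
    rw [(iIndepFun_iff_map_fun_eq_pi_map fun i => (hz (e i)).measurable.aemeasurable).1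
      (hindep.precomp e.injective)]
    simp only [(hz _).map_eq]
  have hmz : Measurable fun ω i => z (e i) ω :=
    measurable_pi_lambda _ fun i => (hz (e i)).measurable
  rw [← hlaw, lintegral_map (by simp only [dotProduct, mulVec]; fun_prop) hmz] at hbound
  refine le_trans (le_of_eq (lintegral_congr fun ω => ?_)) (hbound.trans
    (ENNReal.ofReal_le_ofReal (one_div_sqrt_det_one_sub_le hA (by simp [trace, hdiag]) hr1 hr)))
  have h1 : (fun i => z (e i) ω) ⬝ᵥ (fun i => z (e i) ω) =
      (fun i => z i ω) ⬝ᵥ (fun i => z i ω) := by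
    simp only [dotProduct]
    exact e.sum_comp fun i => z i ω * z i ω
  have h2 : (fun i => z (e i) ω) ⬝ᵥ (1 - A).submatrix e e *ᵥ (fun i => z (e i) ω) =
      (fun i => z i ω) ⬝ᵥ (1 - A) *ᵥ (fun i => z i ω) := by
    simp only [dotProduct, mulVec, submatrix_apply]
    rw [← e.sum_comp]
    refine Finset.sum_congr rfl fun i _ => ?_
    rw [← e.sum_comp]
  rw [h1, h2, sub_mulVec, one_mulVec, dotProduct_sub]
  ring_nf

/-! ### The off-diagonal symmetric part -/

theorem spectralNorm₂_nonneg {n : ℕ} (P : Matrix (Fin n) (Fin n) ℝ) : 0 ≤ spectralNorm₂ P :=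
  norm_nonneg _

theorem abs_dotProduct_mulVec_le {n : ℕ} (P : Matrix (Fin n) (Fin n) ℝ) (x : Fin n → ℝ) :
    |x ⬝ᵥ P *ᵥ x| ≤ spectralNorm₂ P * (x ⬝ᵥ x) := by
  set v : EuclideanSpace ℝ (Fin n) := WithLp.toLp 2 x
  have h1 : inner ℝ v (toEuclideanCLM (n := Fin n) (𝕜 := ℝ) P v) = x ⬝ᵥ P *ᵥ x :=
    inner_toEuclideanCLM P v v
  have h2 : x ⬝ᵥ x = ‖v‖ * ‖v‖ := by
    rw [← real_inner_self_eq_norm_mul_norm, EuclideanSpace.inner_eq_star_dotProduct, star_trivial]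
  rw [← h1, h2]
  calc _ ≤ ‖v‖ * ‖toEuclideanCLM (n := Fin n) (𝕜 := ℝ) P v‖ := abs_real_inner_le_norm _ _
    _ ≤ ‖v‖ * (spectralNorm₂ P * ‖v‖) := by
      gcongr
      exact ContinuousLinearMap.le_opNorm _ _
    _ = _ := by ring

/-- The symmetric part of `P` with its diagonal removed. -/
noncomputable def symOffDiag {n : ℕ} (P : Matrix (Fin n) (Fin n) ℝ) : Matrix (Fin n) (Fin n) ℝ :=
  Matrix.of fun i j => if i = j then 0 else (P i j + P j i) / 2

theorem isHermitian_symOffDiag {n : ℕ} (P : Matrix (Fin n) (Fin n) ℝ) :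
    (symOffDiag P).IsHermitian := by
  ext i j
  simp only [symOffDiag, conjTranspose_apply, of_apply, star_trivial, eq_comm (a := j), add_comm]

theorem dotProduct_mulVec_symOffDiag {n : ℕ} (P : Matrix (Fin n) (Fin n) ℝ) (x : Fin n → ℝ) :
    x ⬝ᵥ symOffDiag P *ᵥ x = x ⬝ᵥ P *ᵥ x - ∑ i, P i i * x i ^ 2 := by
  have hswap : ∑ i, ∑ j, x i * P j i * x j = ∑ i, ∑ j, x i * P i j * x j := by
    rw [Finset.sum_comm]
    exact Finset.sum_congr rfl fun i _ => Finset.sum_congr rfl fun j _ => by ring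
  have hent : ∀ i j, x i * (symOffDiag P i j * x j) =
      x i * P i j * x j / 2 + x i * P j i * x j / 2 - if i = j then P i i * x i ^ 2 else 0 := by
    intro i j
    by_cases h : i = j
    · subst h
      simp only [symOffDiag, of_apply, if_true]
      ring
    · simp only [symOffDiag, of_apply, h, if_false]
      ring
  have hP : x ⬝ᵥ P *ᵥ x = ∑ i, ∑ j, x i * P i j * x j := by
    simp only [dotProduct, mulVec, Finset.mul_sum, mul_assoc]
  rw [hP]
  simp only [dotProduct, mulVec, Finset.mul_sum, hent, Finset.sum_sub_distrib,
    Finset.sum_add_distrib, ← Finset.sum_div, hswap, Finset.sum_ite_eq, Finset.mem_univ, if_true]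
  ring

theorem abs_diag_le_spectralNorm₂ {n : ℕ} (P : Matrix (Fin n) (Fin n) ℝ) (i : Fin n) :
    |P i i| ≤ spectralNorm₂ P := by
  simpa using abs_dotProduct_mulVec_le P (Pi.single i 1)

theorem abs_dotProduct_mulVec_symOffDiag_le {n : ℕ} (P : Matrix (Fin n) (Fin n) ℝ)
    (x : Fin n → ℝ) :
    |x ⬝ᵥ symOffDiag P *ᵥ x| ≤ 2 * spectralNorm₂ P * (x ⬝ᵥ x) := by
  have hdiag : |∑ i, P i i * x i ^ 2| ≤ spectralNorm₂ P * (x ⬝ᵥ x) := by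
    refine (Finset.abs_sum_le_sum_abs _ _).trans ?_
    rw [dotProduct, Finset.mul_sum]
    refine Finset.sum_le_sum fun i _ => ?_
    rw [abs_mul, abs_of_nonneg (sq_nonneg (x i)), ← sq]
    gcongr
    exact abs_diag_le_spectralNorm₂ P i
  rw [dotProduct_mulVec_symOffDiag]
  have := abs_sub (x ⬝ᵥ P *ᵥ x) (∑ i, P i i * x i ^ 2)
  linarith [abs_dotProduct_mulVec_le P x]

theorem frobeniusNorm_sq {n : ℕ} (P : Matrix (Fin n) (Fin n) ℝ) :
    frobeniusNorm P ^ 2 = ∑ i, ∑ j, P i j ^ 2 :=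
  Real.sq_sqrt (Finset.sum_nonneg fun _ _ => Finset.sum_nonneg fun _ _ => sq_nonneg _)

theorem sum_sq_symOffDiag_le {n : ℕ} (P : Matrix (Fin n) (Fin n) ℝ) :
    ∑ i, ∑ j, symOffDiag P i j ^ 2 ≤ frobeniusNorm P ^ 2 := by
  have h : ∀ i j, symOffDiag P i j ^ 2 ≤ P i j ^ 2 / 2 + P j i ^ 2 / 2 := by
    intro i j
    by_cases hij : i = j
    · simp only [symOffDiag, of_apply, hij, if_true]
      nlinarith [sq_nonneg (P j j)]
    · simp only [symOffDiag, of_apply, hij, if_false]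
      nlinarith [sq_nonneg (P i j - P j i)]
  refine (Finset.sum_le_sum fun i _ => Finset.sum_le_sum fun j _ => h i j).trans (le_of_eq ?_)
  have hc : ∑ i, ∑ j, P j i ^ 2 = ∑ i, ∑ j, P i j ^ 2 := Finset.sum_comm
  simp only [Finset.sum_add_distrib, ← Finset.sum_div, hc, frobeniusNorm_sq]
  ring

theorem frobeniusNorm_sq_pos {n : ℕ} {P : Matrix (Fin n) (Fin n) ℝ} (hP : 0 < P.trace) :
    0 < frobeniusNorm P ^ 2 := by
  obtain ⟨i, -, hi⟩ := Finset.exists_lt_of_sum_lt (s := Finset.univ) (f := fun _ : Fin n => (0 : ℝ))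
    (g := fun i => P i i) (by simpa [trace] using hP)
  rw [frobeniusNorm_sq]
  refine Finset.sum_pos' (fun _ _ => Finset.sum_nonneg fun _ _ => sq_nonneg _)
    ⟨i, Finset.mem_univ i, Finset.sum_pos' (fun _ _ => sq_nonneg _)
      ⟨i, Finset.mem_univ i, pow_pos hi 2⟩⟩

/-! ### Tail bound for averages of independent chaoses -/

open scoped Kronecker in
theorem dotProduct_one_kronecker_mulVec {n M : ℕ} (A : Matrix (Fin n) (Fin n) ℝ)
    (x : Fin M × Fin n → ℝ) :
    x ⬝ᵥ ((1 : Matrix (Fin M) (Fin M) ℝ) ⊗ₖ A) *ᵥ x =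
      ∑ i, (fun j => x (i, j)) ⬝ᵥ A *ᵥ (fun j => x (i, j)) := by
  simp only [dotProduct, mulVec, Fintype.sum_prod_type, kroneckerMap_apply, one_apply, ite_mul,
    one_mul, zero_mul]
  refine Finset.sum_congr rfl fun i _ => Finset.sum_congr rfl fun j _ => ?_
  rw [Finset.sum_eq_single i (by simp +contextual [eq_comm]) (by simp)]
  simp

open scoped Kronecker in
theorem sum_sq_one_kronecker {n M : ℕ} (A : Matrix (Fin n) (Fin n) ℝ) :
    ∑ p, ∑ q, ((1 : Matrix (Fin M) (Fin M) ℝ) ⊗ₖ A) p q ^ 2 = M * ∑ i, ∑ j, A i j ^ 2 := by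
  simp only [Fintype.sum_prod_type, kroneckerMap_apply, one_apply, ite_mul, one_mul, zero_mul]
  simp

open scoped Kronecker in
/-- Bernstein-type upper tail. The `M` independent forms are a single chaos whose matrix is block
diagonal, so the exponential moment bound for one chaos applies directly. -/
theorem measure_le_sum_chaos_le {n M : ℕ} {A : Matrix (Fin n) (Fin n) ℝ} (hA : A.IsHermitian)
    (hdiag : ∀ i, A i i = 0) {K V t : ℝ} (hK : 0 ≤ K) (hV : 0 < V) (ht : 0 < t)
    (hAK : ∀ x : Fin n → ℝ, |x ⬝ᵥ A *ᵥ x| ≤ K * (x ⬝ᵥ x)) (hAV : ∑ i, ∑ j, A i j ^ 2 ≤ V)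
    {Ω : Type*} [MeasurableSpace Ω] {μ : Measure Ω} [IsProbabilityMeasure μ]
    {z : Fin M → Fin n → Ω → ℝ} (hz : ∀ i j, IsRademacher (z i j) μ)
    (hindep : iIndepFun (fun ij : Fin M × Fin n => z ij.1 ij.2) μ) :
    μ {ω | M * t ≤ ∑ i, (fun j => z i j ω) ⬝ᵥ A *ᵥ (fun j => z i j ω)} ≤
      ENNReal.ofReal (Real.exp (-(M * t ^ 2 / (8 * V + 8 * K * t)))) := by
  -- The Bernstein choice of parameter: in `-l * t + l ^ 2 * (4 * V) / (2 * (1 - 4 * K * l))` it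
  -- makes the second term equal to `l * t / 2`.
  set l : ℝ := t / (4 * V + 4 * K * t) with hl
  have hden : 0 < 4 * V + 4 * K * t := by positivity
  have hlpos : 0 < l := by positivity
  have hr : 1 - 4 * K * l = 4 * V / (4 * V + 4 * K * t) := by
    rw [hl]
    field_simp
    ring
  have hr1 : 4 * K * l < 1 := by
    have : 0 < 4 * V / (4 * V + 4 * K * t) := by positivity
    linarith
  set G : Ω → ℝ := fun ω => ∑ i, (fun j => z i j ω) ⬝ᵥ A *ᵥ (fun j => z i j ω)
  have hG : Measurable G := by
    have := fun i j => (hz i j).measurable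
    simp only [G, dotProduct, mulVec]
    fun_prop
  let B : Matrix (Fin M × Fin n) (Fin M × Fin n) ℝ := (1 : Matrix (Fin M) (Fin M) ℝ) ⊗ₖ A
  have hBK : ∀ x : Fin M × Fin n → ℝ, |x ⬝ᵥ ((2 * l) • B) *ᵥ x| ≤ 4 * K * l * (x ⬝ᵥ x) := by
    intro x
    have h0 : 0 ≤ x ⬝ᵥ x := Finset.sum_nonneg fun _ _ => mul_self_nonneg _
    have h1 : |x ⬝ᵥ B *ᵥ x| ≤ K * (x ⬝ᵥ x) := by
      rw [dotProduct_one_kronecker_mulVec]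
      refine (Finset.abs_sum_le_sum_abs _ _).trans
        ((Finset.sum_le_sum fun i _ => hAK fun j => x (i, j)).trans (le_of_eq ?_))
      rw [← Finset.mul_sum]
      simp only [dotProduct, Fintype.sum_prod_type]
    rw [smul_mulVec, dotProduct_smul, smul_eq_mul, abs_mul, abs_of_pos (by positivity)]
    have h2 : 2 * l * |x ⬝ᵥ B *ᵥ x| ≤ 2 * l * (K * (x ⬝ᵥ x)) := by gcongr
    have h3 : 0 ≤ 2 * l * (K * (x ⬝ᵥ x)) := by positivity
    linarith
  have hBA : ((2 * l) • B).IsHermitian := by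
    ext p q
    have h := hA.apply p.2 q.2
    simp only [star_trivial] at h
    simp [B, one_apply, eq_comm (a := q.1), h]
  have hmgf := lintegral_exp_chaos_le hBA (fun p => by simp [B, hdiag]) hr1 hBK
    (fun p => hz p.1 p.2) hindep
  have hexp : (∑ p, ∑ q, ((2 * l) • B) p q ^ 2) / (2 * (1 - 4 * K * l)) ≤ M * l * t / 2 := by
    have h1 : ∑ p, ∑ q, ((2 * l) • B) p q ^ 2 = (2 * l) ^ 2 * (M * ∑ i, ∑ j, A i j ^ 2) := by
      rw [← sum_sq_one_kronecker]
      simp only [Matrix.smul_apply, smul_eq_mul, mul_pow, ← Finset.mul_sum, B]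
    rw [h1, hr]
    calc _ ≤ (2 * l) ^ 2 * (M * V) / (2 * (4 * V / (4 * V + 4 * K * t))) := by gcongr
      _ = M * l * (l * (4 * V + 4 * K * t)) / 2 := by
        field_simp
        ring
      _ = _ := by rw [hl, div_mul_cancel₀ _ hden.ne']
  have hmgf' : ∫⁻ ω, ENNReal.ofReal (Real.exp (l * G ω)) ∂μ ≤
      ENNReal.ofReal (Real.exp (M * l * t / 2)) := by
    refine le_trans (le_of_eq (lintegral_congr fun ω => ?_)) (hmgf.trans
      (ENNReal.ofReal_le_ofReal (Real.exp_le_exp.2 hexp)))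
    rw [smul_mulVec, dotProduct_smul, dotProduct_one_kronecker_mulVec, smul_eq_mul]
    congr 2
    simp only [G]
    ring
  have hmarkov := mul_meas_ge_le_lintegral (μ := μ)
    (f := fun ω => ENNReal.ofReal (Real.exp (l * G ω))) (by fun_prop)
    (ENNReal.ofReal (Real.exp (l * (M * t))))
  have hset : {ω | M * t ≤ G ω} ⊆
      {ω | ENNReal.ofReal (Real.exp (l * (M * t))) ≤ ENNReal.ofReal (Real.exp (l * G ω))} := by
    intro ω hω
    simp only [Set.mem_ofPred_eq] at hω ⊢
    gcongr
  have hfinal : ENNReal.ofReal (Real.exp (M * l * t / 2)) =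
      ENNReal.ofReal (Real.exp (l * (M * t))) *
        ENNReal.ofReal (Real.exp (-(M * t ^ 2 / (8 * V + 8 * K * t)))) := by
    rw [← ENNReal.ofReal_mul (Real.exp_pos _).le, ← Real.exp_add]
    congr 2
    rw [hl]
    field_simp
    ring
  have hne : ENNReal.ofReal (Real.exp (l * (M * t))) ≠ 0 := by
    simp [Real.exp_pos]
  refine (measure_mono hset).trans ?_
  rw [← ENNReal.mul_le_mul_iff_right hne ENNReal.ofReal_ne_top, ← hfinal]
  exact hmarkov.trans hmgf'

/-! ### The Hutchinson estimator -/

/-- Since `z i j ^ 2 = 1`, the diagonal of `P` contributes exactly the trace. -/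
theorem ae_sum_symOffDiag_eq {n M : ℕ} (P : Matrix (Fin n) (Fin n) ℝ) (hM : 0 < M)
    {Ω : Type*} [MeasurableSpace Ω] {μ : Measure Ω} [IsProbabilityMeasure μ]
    {z : Fin M → Fin n → Ω → ℝ} (hz : ∀ i j, IsRademacher (z i j) μ) :
    ∀ᵐ ω ∂μ, ∑ i, (fun j => z i j ω) ⬝ᵥ symOffDiag P *ᵥ (fun j => z i j ω) =
      M * (hutchinson P z ω - P.trace) := by
  have h : ∀ᵐ ω ∂μ, ∀ i j, z i j ω ^ 2 = 1 :=
    ae_all_iff.2 fun i => ae_all_iff.2 fun j => (hz i j).ae_sq_eq_one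
  filter_upwards [h] with ω hω
  have hM' : (M : ℝ) ≠ 0 := by positivity
  simp only [dotProduct_mulVec_symOffDiag, hω, mul_one, Finset.sum_sub_distrib]
  rw [hutchinson, mul_sub, ← mul_assoc, mul_one_div_cancel hM', one_mul]
  simp [trace]

theorem theorem3p3 {n : ℕ} (P : Matrix (Fin n) (Fin n) ℝ) (hP : 0 < P.trace)
    {ε δ : ℝ} (hε : 0 < ε) (hδ : 0 < δ) (hδ' : δ < 1)
    {M : ℕ}
    (hM : (M : ℝ) ≥ 8 * ε ^ (-2 : ℤ)
      * (frobeniusNorm P ^ 2 + 2 * spectralNorm₂ P * (ε * P.trace))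
      * Real.log (2 / δ) / P.trace ^ 2)
    {Ω : Type*} [MeasurableSpace Ω] (μ : Measure Ω) [IsProbabilityMeasure μ]
    (z : Fin M → Fin n → Ω → ℝ)
    (hz : ∀ i j, IsRademacher (z i j) μ)
    (hindep : iIndepFun (fun ij : Fin M × Fin n => z ij.1 ij.2) μ) :
    μ.real {ω | |hutchinson P z ω - P.trace| ≥ ε * P.trace} ≤ δ := by
  set t := ε * P.trace with ht_def
  have ht : 0 < t := by positivity
  have hV := frobeniusNorm_sq_pos hP
  have hN := spectralNorm₂_nonneg P
  set V := frobeniusNorm P ^ 2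
  set N := spectralNorm₂ P
  have hlog : 0 < Real.log (2 / δ) := Real.log_pos (by rw [lt_div_iff₀ hδ]; linarith)
  have hQ : 0 < V + 2 * N * t := by positivity
  have hMt : 8 * (V + 2 * N * t) * Real.log (2 / δ) ≤ M * t ^ 2 := by
    have h1 : 8 * ε ^ (-2 : ℤ) * (V + 2 * N * t) * Real.log (2 / δ) / P.trace ^ 2 * t ^ 2 =
        8 * (V + 2 * N * t) * Real.log (2 / δ) := by
      have h2 : ε ^ (-2 : ℤ) * t ^ 2 = P.trace ^ 2 := by
        rw [ht_def, _root_.zpow_neg, mul_pow, ← mul_assoc]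
        have : ε ^ (2 : ℤ) = ε ^ 2 := by norm_cast
        rw [this, inv_mul_cancel₀ (by positivity), one_mul]
      have h3 : P.trace ^ 2 ≠ 0 := by positivity
      rw [div_mul_eq_mul_div, div_eq_iff h3, ← h2]
      ring
    rw [← h1]
    gcongr
  have hMpos : 0 < M := by
    rcases Nat.eq_zero_or_pos M with h | h
    · have : 0 < 8 * (V + 2 * N * t) * Real.log (2 / δ) := by positivity
      rw [h, Nat.cast_zero, zero_mul] at hMt
      linarith
    · exact h
  have hMpos' : (0 : ℝ) < M := by exact_mod_cast hMpos
  have hexp : Real.exp (-(M * t ^ 2 / (8 * V + 8 * (2 * N) * t))) ≤ δ / 2 := by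
    have h1 : Real.log (2 / δ) ≤ M * t ^ 2 / (8 * V + 8 * (2 * N) * t) := by
      rw [le_div_iff₀ (by positivity)]
      linarith
    calc _ ≤ Real.exp (-Real.log (2 / δ)) := by gcongr
      _ = δ / 2 := by rw [Real.exp_neg, Real.exp_log (by positivity), inv_div]
  have hA := isHermitian_symOffDiag P
  have hdiag : ∀ i, symOffDiag P i i = 0 := fun i => by simp [symOffDiag]
  have hup := (measure_le_sum_chaos_le hA hdiag (by positivity) hV ht
    (abs_dotProduct_mulVec_symOffDiag_le P) (sum_sq_symOffDiag_le P) hz hindep).trans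
    (ENNReal.ofReal_le_ofReal hexp)
  have hlow := (measure_le_sum_chaos_le (A := -symOffDiag P) hA.neg (fun i => by simp [hdiag])
    (by positivity) hV ht
    (fun x => by
      rw [neg_mulVec, dotProduct_neg, abs_neg]
      exact abs_dotProduct_mulVec_symOffDiag_le P x)
    (by simpa using sum_sq_symOffDiag_le P) hz hindep).trans (ENNReal.ofReal_le_ofReal hexp)
  have hunion : μ {ω | |hutchinson P z ω - P.trace| ≥ t} ≤ ENNReal.ofReal δ := by
    calc _ ≤ μ ({ω | M * t ≤ ∑ i, (fun j => z i j ω) ⬝ᵥ symOffDiag P *ᵥ (fun j => z i j ω)} ∪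
          {ω | M * t ≤ ∑ i, (fun j => z i j ω) ⬝ᵥ (-symOffDiag P) *ᵥ (fun j => z i j ω)}) := by
          refine measure_mono_ae ?_
          filter_upwards [ae_sum_symOffDiag_eq P hMpos hz] with ω hω h
          rcases le_abs.1 h with h | h
          · refine Or.inl ?_
            change M * t ≤ ∑ i, (fun j => z i j ω) ⬝ᵥ symOffDiag P *ᵥ (fun j => z i j ω)
            rw [hω]
            gcongr
          · refine Or.inr ?_
            change M * t ≤ ∑ i, (fun j => z i j ω) ⬝ᵥ (-symOffDiag P) *ᵥ (fun j => z i j ω)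
            simp only [neg_mulVec, dotProduct_neg, Finset.sum_neg_distrib]
            rw [hω, ← mul_neg]
            gcongr
      _ ≤ ENNReal.ofReal (δ / 2) + ENNReal.ofReal (δ / 2) :=
          (measure_union_le _ _).trans (add_le_add hup hlow)
      _ = ENNReal.ofReal δ := by
          rw [← ENNReal.ofReal_add (by positivity) (by positivity), add_halves]
  exact ENNReal.toReal_le_of_le_ofReal hδ.le hunion
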